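/- Let $E$ be a finite totally ordered set with $n=|E|$ (for example $E=[n]=\{1,\dots,n\}$), and let $\mathbf e_i$ ($i\in E$) be the standard basis vectors of $\mathbb Z^E$. A *polymatroid* over $E$ with rank function $f$ is the set $$P=P_f=\Big\{\mathbf a\in\mathbb Z^{E}\ :\ \sum_{i\in I}a_i\le f(I)\ \text{for all } I\subseteq E,\ \ \sum_{i\in E}a_i=f(E)\Big\},$$ where $f:2^{E}\to\mathbb Z$ satisfies $f(\emptyset)=0$ and $f(I)+f(J)\ge f(I\cup J)+f(I\cap J)$ for all $I,J\subseteq E$. (The set $P$ determines $f$.) The elements of $P$ are called bases. For $\mathbf a\in P$, an index $i\in E$ is *internally active* if $\mathbf a-\mathbf e_i+\mathbf e_j\notin P$ for every $j\in E$ with $j<i$, and *externally active* if $\mathbf a+\mathbf e_i-\mathbf e_j\notin P$ for every $j\in E$ with $j<i$. Let $\iota(\mathbf a)$ and $\epsilon(\mathbf a)$ be the numbers of internally and externally active indices. The *interior* and *exterior polynomials* of $P$ are $$I_P(x)=\sum_{\mathbf a\in P}x^{\,n-\iota(\mathbf a)},\qquad X_P(y)=\sum_{\mathbf a\in P}y^{\,n-\epsilon(\mathbf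 a)}.$$ For $A\subseteq E$, the *deletion* $P\setminus A$ and the *contraction* $P/A$ are the polymatroids over $E\setminus A$ (with the induced order) with rank functions $f_{P\setminus A}(T)=f(T)$ and $f_{P/A}(T)=f(T\cup A)-f(A)$ for $T\subseteq E\setminus A$. A polymatroid $P'$ is a *minor* of $P$ if $P'=(P\setminus A)/B$ or $P'=(P/B)\setminus A$ for some disjoint subsets $A,B\subseteq E$. **Theorem 4.7 (minor-monotonicity).** If $P'$ is a minor of a polymatroid $P$, then $I_{P'}\le I_{P}$ and $X_{P'}\le X_{P}$ coefficientwise; that is, for every $k\ge 0$, the coefficient of $x^k$ in $I_{P'}$ is at most the coefficient of $x^k$ in $I_P$, and the coefficient of $y^k$ in $X_{P'}$ is at most the coefficient of $y^k$ in $X_P$. -/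

import Mathlib

/-- An integer polymatroid over a finite ground set inside a linearly ordered type, presented by
its rank function `f : 2^ground → ℤ`, which satisfies `f ∅ = 0` and is submodular. The values of
`rank` on finsets that are not contained in the ground set are never used. -/
structure IntPolymatroid (α : Type*) [LinearOrder α] where
  /-- The ground set; for a polymatroid over `[n]` it is `{1, …, n}`. -/
  ground : Finset α
  /-- The rank function. -/
  rank : Finset α → ℤ
  rank_empty : rank ∅ = 0
  rank_submodular : ∀ I J : Finset α, I ⊆ ground → J ⊆ ground →
    rank (I ∪ J) + rank (I ∩ J) ≤ rank I + rank J

namespace IntPolymatroid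

variable {α : Type*} [LinearOrder α]

/-- The set of points `P_f ⊆ ℤ^ground` of a polymatroid (its bases). A vector of `ℤ^ground` is
represented by its extension by zero to a function on the ambient type. -/
def bases (P : IntPolymatroid α) : Set (α → ℤ) :=
  {a | (∀ i, i ∉ P.ground → a i = 0) ∧
    (∀ I : Finset α, I ⊆ P.ground → ∑ i ∈ I, a i ≤ P.rank I) ∧
    ∑ i ∈ P.ground, a i = P.rank P.ground}

theorem bases_finite (P : IntPolymatroid α) : P.bases.Finite := by
  have hinj : Set.InjOn (fun (a : α → ℤ) (i : P.ground) => a i) P.bases := by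
    intro a ha b hb hab
    funext i
    by_cases hi : i ∈ P.ground
    · exact congrFun hab ⟨i, hi⟩
    · rw [ha.1 i hi, hb.1 i hi]
  refine Set.Finite.of_finite_image ?_ hinj
  refine (Set.finite_Icc
    (fun i : P.ground => P.rank P.ground - P.rank (P.ground.erase i))
    (fun i : P.ground => P.rank {(i : α)})).subset ?_
  rintro _ ⟨a, ha, rfl⟩
  refine ⟨fun i => ?_, fun i => ?_⟩
  · have h1 := ha.2.1 (P.ground.erase i) (Finset.erase_subset _ _)
    have h2 := Finset.add_sum_erase P.ground a i.2
    have h3 := ha.2.2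
    show P.rank P.ground - P.rank (P.ground.erase i) ≤ a i
    linarith
  · have h1 := ha.2.1 {(i : α)} (Finset.singleton_subset_iff.2 i.2)
    simpa using h1

open Classical in
/-- The internally active indices of a basis `a`: those `i` in the ground set for which
`a - e_i + e_j` is not a basis for any `j < i` of the ground set. -/
noncomputable def intActive (P : IntPolymatroid α) (a : α → ℤ) : Finset α :=
  P.ground.filter fun i =>
    ∀ j ∈ P.ground, j < i → a - Pi.single i 1 + Pi.single j 1 ∉ P.bases

open Classical in
/-- The externally active indices of a basis `a`: those `i` in the ground set for which
`a + e_i - e_j` is not a basis for any `j < i` of the ground set. -/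
noncomputable def extActive (P : IntPolymatroid α) (a : α → ℤ) : Finset α :=
  P.ground.filter fun i =>
    ∀ j ∈ P.ground, j < i → a + Pi.single i 1 - Pi.single j 1 ∉ P.bases

/-- The interior polynomial: the sum over all bases of `x ^ (n - ι(a))`, where `n` is the size of
the ground set and `ι(a)` the number of internally active indices. -/
noncomputable def interiorPoly (P : IntPolymatroid α) : Polynomial ℤ :=
  ∑ a ∈ P.bases_finite.toFinset, Polynomial.X ^ (P.ground.card - (P.intActive a).card)

/-- The exterior polynomial: the sum over all bases of `y ^ (n - ε(a))`, where `n` is the size of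
the ground set and `ε(a)` the number of externally active indices. -/
noncomputable def exteriorPoly (P : IntPolymatroid α) : Polynomial ℤ :=
  ∑ a ∈ P.bases_finite.toFinset, Polynomial.X ^ (P.ground.card - (P.extActive a).card)

/-- The deletion `P \ A`, a polymatroid over `ground \ A` with rank function `T ↦ f T`. -/
def delete (P : IntPolymatroid α) (A : Finset α) (_hA : A ⊆ P.ground) : IntPolymatroid α where
  ground := P.ground \ A
  rank T := P.rank T
  rank_empty := P.rank_empty
  rank_submodular I J hI hJ := P.rank_submodular I J
    (hI.trans Finset.sdiff_subset) (hJ.trans Finset.sdiff_subset)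

/-- The contraction `P / A`, a polymatroid over `ground \ A` with rank function
`T ↦ f (T ∪ A) - f A`. -/
def contract (P : IntPolymatroid α) (A : Finset α) (hA : A ⊆ P.ground) : IntPolymatroid α where
  ground := P.ground \ A
  rank T := P.rank (T ∪ A) - P.rank A
  rank_empty := by simp
  rank_submodular I J hI hJ := by
    have h := P.rank_submodular (I ∪ A) (J ∪ A)
      (Finset.union_subset (hI.trans Finset.sdiff_subset) hA)
      (Finset.union_subset (hJ.trans Finset.sdiff_subset) hA)
    rw [← Finset.union_union_distrib_right, ← Finset.inter_union_distrib_right] at h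
    linarith

/-- Equality of polymatroids: the same ground set and the same set of points. -/
def Same (P Q : IntPolymatroid α) : Prop :=
  P.ground = Q.ground ∧ P.bases = Q.bases

/-- `P'` is a minor of `P` if `P' = (P \ A) / B` or `P' = (P / B) \ A` for disjoint subsets `A`
and `B` of the ground set. -/
def IsMinor (P' P : IntPolymatroid α) : Prop :=
  ∃ (A B : Finset α) (hA : A ⊆ P.ground) (hB : B ⊆ P.ground) (hAB : Disjoint A B),
    Same P' ((P.delete A hA).contract B (Finset.subset_sdiff.2 ⟨hB, hAB.symm⟩)) ∨
    Same P' ((P.contract B hB).delete A (Finset.subset_sdiff.2 ⟨hA, hAB⟩))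

end IntPolymatroid

/-! Only the exchange property of bases matters. Fix an order and lower a basis by a nonnegative
integer vector to get `c`. Exactly one basis `a ≥ c` has `a - c` supported on its internally active
indices (`eq_of_active_above`, `exists_active_above`). Counting the vectors `c` by total decrease
`k` gives `∑ a, (1 - X)⁻¹ ^ ι(a) = ∑ k, |lowerShadow B G k| X ^ k`. The right side ignores the
order, hence so does the interior polynomial (`activityPoly_eq`).

Deleting or contracting `t` amounts to taking the slice of bases where `a t` is minimal or maximal.
Move `t` last or first in the order: on the slice `t` is active and the other activities are
unchanged, so `n - ι` is preserved and the slice contributes a subsum of the full polynomial.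
Negating all bases exchanges external with internal activity, and induction on the removed set
completes the proof. -/

open Finset

/-! ### Exchange families and order independence of the interior polynomial. -/

section ExchangeFamilies

variable {α : Type*} [DecidableEq α]

/-- A finite set of integer vectors supported on `G`, with constant coordinate sum, satisfying the
two one-sided exchange axioms of an M-convex set. -/
structure IsExchangeFamily (B : Finset (α → ℤ)) (G : Finset α) : Prop where
  eq_zero : ∀ a ∈ B, ∀ i ∉ G, a i = 0
  sum_eq : ∀ a ∈ B, ∀ b ∈ B, ∑ i ∈ G, a i = ∑ i ∈ G, b i
  exists_lower : ∀ a ∈ B, ∀ b ∈ B, ∀ j, a j < b j →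
    ∃ i, b i < a i ∧ a - Pi.single i 1 + Pi.single j 1 ∈ B
  exists_raise : ∀ a ∈ B, ∀ b ∈ B, ∀ i, b i < a i →
    ∃ j, a j < b j ∧ a - Pi.single i 1 + Pi.single j 1 ∈ B

open Classical in
/-- The indices of `G` that are internally active at `a`, for the order on `G` pulled back
along `ρ`. -/
noncomputable def activeSet {β : Type*} [LinearOrder β] (ρ : α → β) (B : Finset (α → ℤ))
    (G : Finset α) (a : α → ℤ) : Finset α :=
  G.filter fun i => ∀ j ∈ G, ρ j < ρ i → a - Pi.single i 1 + Pi.single j 1 ∉ B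

/-- The interior polynomial of `B`, for the order on `G` pulled back along `ρ`. -/
noncomputable def activityPoly {β : Type*} [LinearOrder β] (ρ : α → β) (B : Finset (α → ℤ))
    (G : Finset α) : Polynomial ℤ :=
  ∑ a ∈ B, Polynomial.X ^ (G.card - (activeSet ρ B G a).card)

theorem mem_activeSet {β : Type*} [LinearOrder β] {ρ : α → β} {B : Finset (α → ℤ)}
    {G : Finset α} {a : α → ℤ} {i : α} : i ∈ activeSet ρ B G a ↔
      i ∈ G ∧ ∀ j ∈ G, ρ j < ρ i → a - Pi.single i 1 + Pi.single j 1 ∉ B := by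
  simp [activeSet]

theorem activeSet_subset {β : Type*} [LinearOrder β] (ρ : α → β) (B : Finset (α → ℤ))
    (G : Finset α) (a : α → ℤ) : activeSet ρ B G a ⊆ G :=
  fun _ hi => (mem_activeSet.1 hi).1

open Classical in
/-- The vectors obtained from members of `B` by lowering coordinates in `G` by `k` in total. -/
noncomputable def lowerShadow (B : Finset (α → ℤ)) (G : Finset α) (k : ℕ) : Finset (α → ℤ) :=
  (B ×ˢ G.finsuppAntidiag k).image fun p => p.1 - fun i => (p.2 i : ℤ)

namespace IsExchangeFamily

variable {B : Finset (α → ℤ)} {G : Finset α} {β : Type*} [LinearOrder β] {ρ : α → β}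

theorem neg (h : IsExchangeFamily B G) :
    IsExchangeFamily (B.map (Equiv.neg (α → ℤ)).toEmbedding) G := by
  have key : ∀ (a : α → ℤ) (i j : α),
      -a - Pi.single i 1 + Pi.single j 1 = -(a - Pi.single j 1 + Pi.single i 1) := by
    intro a i j; abel
  refine ⟨?_, ?_, ?_, ?_⟩ <;> simp only [mem_map, forall_exists_index, and_imp,
    forall_apply_eq_imp_iff₂, Equiv.coe_toEmbedding, Equiv.neg_apply]
  · intro a ha i hi
    simp [h.eq_zero a ha i hi]
  · intro a ha b hb
    simp [h.sum_eq a ha b hb]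
  · intro a ha b hb j hj
    obtain ⟨i, hi, hm⟩ := h.exists_raise a ha b hb j (by simpa using hj)
    exact ⟨i, by simpa using hi, _, hm, (key a i j).symm⟩
  · intro a ha b hb j hj
    obtain ⟨i, hi, hm⟩ := h.exists_lower a ha b hb j (by simpa using hj)
    exact ⟨i, by simpa using hi, _, hm, (key a j i).symm⟩

/-- At the least index `j` where they differ, say `a j < b j`, exchange lowers some `i` with `c i ≤
b i < a i`. Then `i` is active at `a` and lies after `j`, so this exchange is forbidden. -/
theorem eq_of_active_above (h : IsExchangeFamily B G) (hρ : Function.Injective ρ)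
    {a b c : α → ℤ} (ha : a ∈ B) (hb : b ∈ B) (hca : c ≤ a) (hcb : c ≤ b)
    (hac : ∀ i, c i < a i → i ∈ activeSet ρ B G a)
    (hbc : ∀ i, c i < b i → i ∈ activeSet ρ B G b) : a = b := by
  by_contra hab
  have hmem : ∀ i, a i ≠ b i → i ∈ G := by
    intro i hi
    by_contra hiG
    exact hi ((h.eq_zero a ha i hiG).trans (h.eq_zero b hb i hiG).symm)
  obtain ⟨i₀, hi₀⟩ := Function.ne_iff.1 hab
  obtain ⟨j, hj, hmin⟩ := exists_min_image (G.filter fun i => a i ≠ b i) ρ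
    ⟨i₀, mem_filter.2 ⟨hmem _ hi₀, hi₀⟩⟩
  rw [mem_filter] at hj
  have main : ∀ a ∈ B, ∀ b ∈ B, c ≤ b → (∀ i, c i < a i → i ∈ activeSet ρ B G a) →
      (∀ i, a i ≠ b i → i ∈ G ∧ ρ j ≤ ρ i) → a j < b j → False := by
    intro a ha b hb hcb hac hmin hlt
    obtain ⟨i, hi, hm⟩ := h.exists_lower a ha b hb j hlt
    have hij : j ≠ i := by rintro rfl; omega
    have hact := hac i ((hcb i).trans_lt hi)
    exact (mem_activeSet.1 hact).2 j hj.1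
      (lt_of_le_of_ne (hmin i hi.ne').2 fun e => hij (hρ e)) hm
  have hmin' : ∀ i, a i ≠ b i → i ∈ G ∧ ρ j ≤ ρ i := fun i hi =>
    ⟨hmem i hi, hmin i (mem_filter.2 ⟨hmem i hi, hi⟩)⟩
  rcases lt_or_gt_of_ne hj.2 with hlt | hlt
  · exact main a ha b hb hcb hac hmin' hlt
  · exact main b hb a ha hca hbc (fun i hi => hmin' i hi.symm) hlt

/-- Among the members above `c`, one that shifts the most weight to early indices works: an inactive
`i` with `c i < a i` would allow a further shift. -/
theorem exists_active_above (h : IsExchangeFamily B G) {b c : α → ℤ} (hb : b ∈ B) (hcb : c ≤ b)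
    (hc : ∀ i ∉ G, c i = 0) :
    ∃ a ∈ B, c ≤ a ∧ ∀ i, c i < a i → i ∈ activeSet ρ B G a := by
  classical
  -- This weight is strictly decreasing along the order on `G`.
  set w : α → ℤ := fun i => ((G.filter fun j => ρ i < ρ j).card : ℤ) with hw
  have hwlt : ∀ i ∈ G, ∀ j, ρ j < ρ i → w i < w j := by
    intro i hi j hji
    refine Int.ofNat_lt.2 (card_lt_card ⟨fun x hx => ?_, fun hsub => ?_⟩)
    · rw [mem_filter] at hx ⊢
      exact ⟨hx.1, hji.trans hx.2⟩
    · exact lt_irrefl _ (mem_filter.1 (hsub (mem_filter.2 ⟨hi, hji⟩))).2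
  obtain ⟨a, ha, hmax⟩ := exists_max_image (B.filter fun a => c ≤ a)
    (fun a => ∑ i ∈ G, w i * a i) ⟨b, mem_filter.2 ⟨hb, hcb⟩⟩
  rw [mem_filter] at ha
  refine ⟨a, ha.1, ha.2, fun i hi => ?_⟩
  have hiG : i ∈ G := by
    by_contra hiG
    rw [h.eq_zero a ha.1 i hiG, hc i hiG] at hi
    exact lt_irrefl _ hi
  refine mem_activeSet.2 ⟨hiG, fun j hj hji hm => ?_⟩
  have hle : c ≤ a - Pi.single i 1 + Pi.single j 1 := by
    intro x
    have h1 : c x ≤ a x := ha.2 x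
    have h2 : (0 : ℤ) ≤ (Pi.single j 1 : α → ℤ) x := by
      by_cases e : x = j
      · subst e; simp
      · simp [e]
    by_cases hx : x = i
    · subst hx
      simp only [Pi.add_apply, Pi.sub_apply, Pi.single_eq_same]
      omega
    · simp only [Pi.add_apply, Pi.sub_apply, Pi.single_eq_of_ne hx]
      omega
  have := hmax _ (mem_filter.2 ⟨hm, hle⟩)
  have hlt := hwlt i hiG j hji
  simp only [Pi.add_apply, Pi.sub_apply, mul_add, mul_sub, sum_add_distrib, sum_sub_distrib,
    Pi.single_apply, mul_ite, mul_one, mul_zero, sum_ite_eq', hiG, hj, if_true] at this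
  omega

/-- Subtraction `(a, m) ↦ a - m` is a bijection onto the shadow, by uniqueness and existence of the
basis with active surplus. -/
theorem sum_card_antidiagonal_active (h : IsExchangeFamily B G) (hρ : Function.Injective ρ)
    (k : ℕ) :
    ∑ a ∈ B, ((activeSet ρ B G a).finsuppAntidiag k).card = (lowerShadow B G k).card := by
  classical
  rw [← card_sigma]
  refine card_nbij (fun p => p.1 - fun i => (p.2 i : ℤ)) ?_ ?_ ?_
  · rintro ⟨a, m⟩ hp
    rw [mem_coe, mem_sigma] at hp
    exact mem_coe.2 <| mem_image.2 ⟨(a, m), mem_product.2 ⟨hp.1,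
      finsuppAntidiag_mono (activeSet_subset ..) _ hp.2⟩, rfl⟩
  · rintro ⟨a, m⟩ hp ⟨b, l⟩ hq he
    simp only [mem_coe, mem_sigma, mem_finsuppAntidiag] at hp hq
    simp only at he
    have he' : ∀ i, a i - m i = b i - l i := fun i => congrFun he i
    have hab : a = b := by
      refine h.eq_of_active_above hρ hp.1 hq.1 (c := fun i => a i - m i) ?_ ?_ ?_ ?_
      · intro i; simp
      · intro i; simp [he' i]
      · intro i hi
        exact hp.2.2 (Finsupp.mem_support_iff.2 fun e => by simp [e] at hi)
      · intro i hi
        simp only [he'] at hi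
        exact hq.2.2 (Finsupp.mem_support_iff.2 fun e => by simp [e] at hi)
    subst hab
    have : m = l := Finsupp.ext fun i => by have := he' i; omega
    rw [this]
  · intro c hcm
    obtain ⟨⟨b, l⟩, hp, rfl⟩ := mem_image.1 (mem_coe.1 hcm)
    rw [mem_product, mem_finsuppAntidiag] at hp
    obtain ⟨hb, hl, hls⟩ := hp
    simp only at hb hl hls
    have hl0 : ∀ i ∉ G, l i = 0 := fun i hi =>
      Finsupp.notMem_support_iff.1 fun hh => hi (hls hh)
    obtain ⟨a, ha, hca, hact⟩ := h.exists_active_above (ρ := ρ) hb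
      (c := b - fun i => (l i : ℤ)) (fun i => by simp)
      (fun i hi => by simp [h.eq_zero b hb i hi, hl0 i hi])
    have hca' : ∀ i, b i - l i ≤ a i := hca
    have hact' : ∀ i, b i - l i < a i → i ∈ activeSet ρ B G a := hact
    have hsupp : ∀ i, (a i - (b i - l i)).toNat ≠ 0 → i ∈ activeSet ρ B G a :=
      fun i hi => hact' i (by omega)
    refine ⟨⟨a, Finsupp.onFinset _ (fun i => (a i - (b i - l i)).toNat) hsupp⟩, ?_, ?_⟩
    · rw [mem_coe, mem_sigma, mem_finsuppAntidiag]
      refine ⟨ha, ?_, Finsupp.support_onFinset_subset (hf := hsupp)⟩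
      have h1 : (activeSet ρ B G a).sum (fun i => (a i - (b i - l i)).toNat) = k := by
        rw [sum_subset (activeSet_subset ρ B G a) fun i _ hi =>
          by_contra fun e => hi (hsupp i e)]
        zify
        rw [sum_congr rfl fun i _ => Int.toNat_of_nonneg (by have := hca' i; omega),
          sum_sub_distrib, sum_sub_distrib, h.sum_eq a ha b hb, ← hl]
        push_cast
        ring
      exact h1
    · funext i
      have := hca' i
      simp only [Pi.sub_apply, Finsupp.onFinset_apply]
      omega

open PowerSeries in
theorem sum_mk_one_pow_card_active (h : IsExchangeFamily B G) (hρ : Function.Injective ρ) :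
    ∑ a ∈ B, (PowerSeries.mk 1 : ℤ⟦X⟧) ^ (activeSet ρ B G a).card =
      PowerSeries.mk fun k => ((lowerShadow B G k).card : ℤ) := by
  ext k
  rw [map_sum, coeff_mk, ← h.sum_card_antidiagonal_active hρ, Nat.cast_sum]
  refine sum_congr rfl fun a _ => ?_
  rw [← prod_const, coeff_prod]
  simp

open PowerSeries in
-- Multiplying `(1 - X)⁻¹ ^ ι(a)` by `(1 - X) ^ n` leaves `(1 - X) ^ (n - ι(a))`.
theorem activityPoly_aeval (h : IsExchangeFamily B G) (hρ : Function.Injective ρ) :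
    (((activityPoly ρ B G).comp (1 - Polynomial.X) : Polynomial ℤ) : ℤ⟦X⟧) =
      (1 - X) ^ G.card * PowerSeries.mk fun k => ((lowerShadow B G k).card : ℤ) := by
  rw [← h.sum_mk_one_pow_card_active hρ, activityPoly, Polynomial.sum_comp, mul_sum,
    ← Polynomial.coeToPowerSeries.ringHom_apply, map_sum]
  refine sum_congr rfl fun a _ => ?_
  obtain ⟨d, hd⟩ := Nat.exists_eq_add_of_le (card_le_card (activeSet_subset ρ B G a))
  rw [hd, Nat.add_sub_cancel_left, add_comm, pow_add, mul_assoc, ← mul_pow, mul_comm (1 - X),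
    mk_one_mul_one_sub_eq_one, one_pow, mul_one, Polynomial.X_pow_comp, map_pow]
  simp

/-- The interior polynomial does not depend on the order of the ground set. -/
theorem activityPoly_eq {γ : Type*} [LinearOrder γ] {σ : α → γ} (h : IsExchangeFamily B G)
    (hρ : Function.Injective ρ) (hσ : Function.Injective σ) :
    activityPoly ρ B G = activityPoly σ B G := by
  have h1 := (h.activityPoly_aeval hρ).trans (h.activityPoly_aeval hσ).symm
  -- The substitution `X ↦ 1 - X` is an involution.
  have h2 := congrArg (fun p : Polynomial ℤ => p.comp (1 - Polynomial.X))
    (Polynomial.coe_injective _ h1)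
  simpa [Polynomial.comp_assoc] using h2

end IsExchangeFamily
end ExchangeFamilies

/-! ### Slices where a coordinate is extremal. -/

section Slices

variable {α : Type*} [DecidableEq α] {B B' : Finset (α → ℤ)} {G : Finset α} {t : α} {v : ℤ}
  {β : Type*} [LinearOrder β] {ρ : α → β}

/-- `hlow` makes `t` active; `hraise` says that `t` never destroys the activity of a later index. -/
theorem activeSet_slice (ht : t ∈ G) (hB' : ∀ b, b ∈ B' ↔ b t = 0 ∧ b + Pi.single t v ∈ B)
    {b : α → ℤ} (hb : b ∈ B')
    (hlow : ∀ j ∈ G, ρ j < ρ t → b + Pi.single t v - Pi.single t 1 + Pi.single j 1 ∉ B)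
    (hraise : ∀ i ∈ G, ρ t < ρ i → b + Pi.single t v - Pi.single i 1 + Pi.single t 1 ∉ B) :
    activeSet ρ B G (b + Pi.single t v) = insert t (activeSet ρ B' (G.erase t) b) := by
  have hbt := ((hB' b).1 hb).1
  have key : ∀ i j, i ≠ t → j ≠ t → (b - Pi.single i 1 + Pi.single j 1 ∈ B' ↔
      b + Pi.single t v - Pi.single i 1 + Pi.single j 1 ∈ B) := by
    intro i j hi hj
    rw [hB', show b - Pi.single i 1 + Pi.single j 1 + Pi.single t v =
      b + Pi.single t v - Pi.single i 1 + Pi.single j 1 by abel]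
    simp [hbt, hi.symm, hj.symm]
  ext i
  rw [mem_insert, mem_activeSet, mem_activeSet]
  by_cases hi : i = t
  · subst hi
    simpa [ht] using hlow
  · simp only [hi, false_or, mem_erase, ne_eq, not_false_eq_true, true_and]
    refine and_congr_right fun hiG => ⟨fun hh j hj hji => ?_, fun hh j hj hji => ?_⟩
    · rw [key i j hi hj.1]
      exact hh j hj.2 hji
    · by_cases hjt : j = t
      · subst hjt
        exact hraise i hiG hji
      · rw [← key i j hi hjt]
        exact hh j ⟨hjt, hj⟩ hji

theorem coeff_activityPoly_slice_le_of_activeSet (ht : t ∈ G)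
    (hB' : ∀ b, b ∈ B' ↔ b t = 0 ∧ b + Pi.single t v ∈ B)
    (hact : ∀ b ∈ B',
      activeSet ρ B G (b + Pi.single t v) = insert t (activeSet ρ B' (G.erase t) b)) (k : ℕ) :
    (activityPoly ρ B' (G.erase t)).coeff k ≤ (activityPoly ρ B G).coeff k := by
  rw [activityPoly, activityPoly, Polynomial.finsetSum_coeff, Polynomial.finsetSum_coeff]
  calc _ = ∑ a ∈ B'.map (addRightEmbedding (Pi.single t v)),
        (Polynomial.X ^ (G.card - (activeSet ρ B G a).card) : Polynomial ℤ).coeff k := by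
        rw [sum_map]
        refine sum_congr rfl fun b hb => ?_
        have hsub := activeSet_subset ρ B' (G.erase t) b
        have hle := card_le_card hsub
        rw [addRightEmbedding_apply, hact b hb,
          card_insert_of_notMem fun hh => notMem_erase _ _ (hsub hh), card_erase_of_mem ht,
          Nat.sub_sub, add_comm 1]
    _ ≤ _ := by
        refine sum_le_sum_of_subset_of_nonneg ?_ fun a _ _ => ?_
        · intro a ha
          obtain ⟨b, hb, rfl⟩ := mem_map.1 ha
          exact ((hB' b).1 hb).2
        · rw [Polynomial.coeff_X_pow]
          split_ifs <;> simp

/-- The coefficients of the interior polynomial do not increase on passing to the slice of an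
exchange family where a coordinate is extremal. -/
theorem IsExchangeFamily.coeff_activityPoly_slice_le (h : IsExchangeFamily B G)
    (h' : IsExchangeFamily B' (G.erase t)) (hρ : Function.Injective ρ) (ht : t ∈ G)
    (hB' : ∀ b, b ∈ B' ↔ b t = 0 ∧ b + Pi.single t v ∈ B)
    (hv : (∀ a ∈ B, v ≤ a t) ∨ (∀ a ∈ B, a t ≤ v)) (k : ℕ) :
    (activityPoly ρ B' (G.erase t)).coeff k ≤ (activityPoly ρ B G).coeff k := by
  rcases hv with hv | hv
  -- Minimal slice: put `t` last, since it cannot be lowered and precedes nothing.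
  · let σ : α → WithTop β := fun i => if i = t then ⊤ else (ρ i : WithTop β)
    have hσ : Function.Injective σ := by
      intro i j hij
      by_cases hi : i = t <;> by_cases hj : j = t <;> simp_all [σ, hρ.eq_iff]
    rw [h.activityPoly_eq hρ hσ, h'.activityPoly_eq hρ hσ]
    refine coeff_activityPoly_slice_le_of_activeSet ht hB' (fun b hb => ?_) k
    have hbt := ((hB' b).1 hb).1
    refine activeSet_slice ht hB' hb (fun j _ hjt hm => ?_) (fun i _ hti => ?_)
    · have hne : t ≠ j := by rintro rfl; exact lt_irrefl _ hjt
      have := hv _ hm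
      simp [hbt, hne] at this
    · simp [σ] at hti
  -- Maximal slice: put `t` first, so it is trivially active and cannot be raised.
  · let σ : α → WithBot β := fun i => if i = t then ⊥ else (ρ i : WithBot β)
    have hσ : Function.Injective σ := by
      intro i j hij
      by_cases hi : i = t <;> by_cases hj : j = t <;> simp_all [σ, hρ.eq_iff]
    rw [h.activityPoly_eq hρ hσ, h'.activityPoly_eq hρ hσ]
    refine coeff_activityPoly_slice_le_of_activeSet ht hB' (fun b hb => ?_) k
    have hbt := ((hB' b).1 hb).1
    refine activeSet_slice ht hB' hb (fun j _ hjt => ?_) (fun i _ hti hm => ?_)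
    · simp [σ] at hjt
    · have hne : t ≠ i := by rintro rfl; exact lt_irrefl _ hti
      have := hv _ hm
      simp [hbt, hne] at this

end Slices

/-! ### Polymatroid bases form an exchange family. -/

namespace IntPolymatroid

variable {α : Type*} [LinearOrder α] {P : IntPolymatroid α} {a b : α → ℤ}

theorem sum_sub_single_add_single (a : α → ℤ) (i j : α) (I : Finset α) :
    ∑ x ∈ I, (a - Pi.single i 1 + Pi.single j 1 : α → ℤ) x =
      ∑ x ∈ I, a x - (if i ∈ I then 1 else 0) + (if j ∈ I then 1 else 0) := by
  simp [sum_add_distrib, sum_sub_distrib, Pi.single_apply]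

theorem tight_union_inter (ha : a ∈ P.bases) {I J : Finset α} (hI : I ⊆ P.ground)
    (hJ : J ⊆ P.ground) (hIt : ∑ i ∈ I, a i = P.rank I) (hJt : ∑ i ∈ J, a i = P.rank J) :
    ∑ i ∈ I ∪ J, a i = P.rank (I ∪ J) ∧ ∑ i ∈ I ∩ J, a i = P.rank (I ∩ J) := by
  have h1 := ha.2.1 (I ∪ J) (union_subset hI hJ)
  have h2 := ha.2.1 (I ∩ J) (inter_subset_left.trans hI)
  have h3 := P.rank_submodular I J hI hJ
  have h4 := sum_union_inter (s₁ := I) (s₂ := J) (f := a)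
  constructor <;> linarith

/-- The move changes each subset sum by at most one, so only a tight set that gains `j` without
losing `i` can be violated. -/
theorem exists_tight_of_notMem (ha : a ∈ P.bases) {i j : α} (hi : i ∈ P.ground)
    (hj : j ∈ P.ground) (h : a - Pi.single i 1 + Pi.single j 1 ∉ P.bases) :
    ∃ I ⊆ P.ground, ∑ x ∈ I, a x = P.rank I ∧ j ∈ I ∧ i ∉ I := by
  by_contra! hcon
  refine h ⟨fun x hx => ?_, fun I hI => ?_, ?_⟩
  · have h1 : x ≠ i := by rintro rfl; exact hx hi
    have h2 : x ≠ j := by rintro rfl; exact hx hj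
    simp [ha.1 x hx, h1, h2]
  · rw [sum_sub_single_add_single]
    have h1 := ha.2.1 I hI
    have h2 := hcon I hI
    by_cases e : ∑ x ∈ I, a x = P.rank I
    · by_cases hjI : j ∈ I
      · simp [hjI, h2 e hjI, e]
      · rw [if_neg hjI]
        split_ifs <;> omega
    · split_ifs <;> omega
  · rw [sum_sub_single_add_single, ha.2.2]
    simp [hi, hj]

/-- If every exchange fails, intersecting the obstructing tight sets gives a tight set containing
`j` on which `a ≤ b`. Then `b` exceeds the rank there. -/
theorem exists_lower (ha : a ∈ P.bases) (hb : b ∈ P.bases) {j : α} (hj : a j < b j) :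
    ∃ i, b i < a i ∧ a - Pi.single i 1 + Pi.single j 1 ∈ P.bases := by
  by_contra! hcon
  have hjG : j ∈ P.ground := by
    by_contra hjG
    simp [ha.1 j hjG, hb.1 j hjG] at hj
  have key : ∀ S ⊆ P.ground.filter fun i => b i < a i,
      ∃ I ⊆ P.ground, ∑ x ∈ I, a x = P.rank I ∧ j ∈ I ∧ ∀ i ∈ S, i ∉ I := by
    intro S
    induction S using Finset.induction_on with
    | empty => exact fun _ => ⟨P.ground, Subset.rfl, ha.2.2, hjG, by simp⟩
    | insert i S _ ih =>
      intro hS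
      rw [insert_subset_iff, mem_filter] at hS
      obtain ⟨I, hI, hIt, hjI, hIS⟩ := ih hS.2
      obtain ⟨J, hJ, hJt, hjJ, hiJ⟩ :=
        exists_tight_of_notMem ha hS.1.1 hjG (hcon i hS.1.2)
      refine ⟨I ∩ J, inter_subset_left.trans hI, (tight_union_inter ha hI hJ hIt hJt).2,
        mem_inter.2 ⟨hjI, hjJ⟩, fun x hx hxI => ?_⟩
      rw [mem_inter] at hxI
      rcases mem_insert.1 hx with rfl | hx
      · exact hiJ hxI.2
      · exact hIS x hx hxI.1
  obtain ⟨I, hI, hIt, hjI, hIS⟩ := key _ Subset.rfl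
  have hlt : ∑ x ∈ I, a x < ∑ x ∈ I, b x := by
    refine sum_lt_sum (fun x hx => ?_) ⟨j, hjI, hj⟩
    by_contra! hlt
    exact hIS x (mem_filter.2 ⟨hI hx, hlt⟩) hx
  have := hb.2.1 I hI
  omega

/-- Dual to `exists_lower`: the union of the obstructing tight sets avoids `i` and contains every
index with `a < b`, so `b` has too small a sum on its complement. -/
theorem exists_raise (ha : a ∈ P.bases) (hb : b ∈ P.bases) {i : α} (hi : b i < a i) :
    ∃ j, a j < b j ∧ a - Pi.single i 1 + Pi.single j 1 ∈ P.bases := by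
  by_contra! hcon
  have hiG : i ∈ P.ground := by
    by_contra hiG
    simp [ha.1 i hiG, hb.1 i hiG] at hi
  have key : ∀ S ⊆ P.ground.filter fun j => a j < b j,
      ∃ I ⊆ P.ground, ∑ x ∈ I, a x = P.rank I ∧ i ∉ I ∧ S ⊆ I := by
    intro S
    induction S using Finset.induction_on with
    | empty => exact fun _ => ⟨∅, by simp, by simp [P.rank_empty], by simp, by simp⟩
    | insert j S _ ih =>
      intro hS
      rw [insert_subset_iff, mem_filter] at hS
      obtain ⟨I, hI, hIt, hiI, hIS⟩ := ih hS.2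
      obtain ⟨J, hJ, hJt, hjJ, hiJ⟩ :=
        exists_tight_of_notMem ha hiG hS.1.1 (hcon j hS.1.2)
      refine ⟨I ∪ J, union_subset hI hJ, (tight_union_inter ha hI hJ hIt hJt).1,
        by simp [hiI, hiJ], insert_subset (mem_union_right _ hjJ)
          (hIS.trans subset_union_left)⟩
  obtain ⟨I, hI, hIt, hiI, hIS⟩ := key _ Subset.rfl
  have hlt : ∑ x ∈ P.ground \ I, b x < ∑ x ∈ P.ground \ I, a x := by
    refine sum_lt_sum (fun x hx => ?_) ⟨i, mem_sdiff.2 ⟨hiG, hiI⟩, hi⟩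
    rw [mem_sdiff] at hx
    by_contra! hlt
    exact hx.2 (hIS (mem_filter.2 ⟨hx.1, hlt⟩))
  have h1 := hb.2.1 I hI
  have h2 := sum_sdiff hI (f := a)
  have h3 := sum_sdiff hI (f := b)
  have h4 := ha.2.2
  have h5 := hb.2.2
  omega

theorem isExchangeFamily (P : IntPolymatroid α) :
    IsExchangeFamily P.bases_finite.toFinset P.ground := by
  refine ⟨?_, ?_, ?_, ?_⟩ <;> simp only [Set.Finite.mem_toFinset]
  · exact fun a ha => ha.1
  · exact fun a ha b hb => ha.2.2.trans hb.2.2.symm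
  · exact fun a ha b hb j hj => exists_lower ha hb hj
  · exact fun a ha b hb i hi => exists_raise ha hb hi

theorem interiorPoly_eq_activityPoly (P : IntPolymatroid α) :
    P.interiorPoly = activityPoly id P.bases_finite.toFinset P.ground := by
  refine sum_congr rfl fun a _ => ?_
  congr 3
  ext i
  simp [intActive, mem_activeSet]

theorem exteriorPoly_eq_activityPoly (P : IntPolymatroid α) :
    P.exteriorPoly = activityPoly id
      (P.bases_finite.toFinset.map (Equiv.neg (α → ℤ)).toEmbedding) P.ground := by
  rw [activityPoly, sum_map]
  refine sum_congr rfl fun a _ => ?_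
  congr 3
  ext i
  have key : ∀ j, -a - Pi.single i 1 + Pi.single j 1 = -(a + Pi.single i 1 - Pi.single j 1) := by
    intro j; abel
  simp [extActive, mem_activeSet, key]

/-- Coefficientwise comparison of the interior and of the exterior polynomials. -/
def CoeffLE (P Q : IntPolymatroid α) : Prop :=
  (∀ k : ℕ, P.interiorPoly.coeff k ≤ Q.interiorPoly.coeff k) ∧
    (∀ k : ℕ, P.exteriorPoly.coeff k ≤ Q.exteriorPoly.coeff k)

theorem CoeffLE.trans {P Q R : IntPolymatroid α} (h : CoeffLE P Q) (h' : CoeffLE Q R) :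
    CoeffLE P R :=
  ⟨fun k => (h.1 k).trans (h'.1 k), fun k => (h.2 k).trans (h'.2 k)⟩

theorem Same.coeffLE {P Q : IntPolymatroid α} (h : Same P Q) : CoeffLE P Q := by
  have h2 : P.bases_finite.toFinset = Q.bases_finite.toFinset := by
    ext a; simp [h.2]
  constructor <;> intro k
  · rw [interiorPoly_eq_activityPoly, interiorPoly_eq_activityPoly, h.1, h2]
  · rw [exteriorPoly_eq_activityPoly, exteriorPoly_eq_activityPoly, h.1, h2]

/-! ### Deletions and contractions as slices. -/

theorem coeffLE_of_slice {P Q : IntPolymatroid α} {t : α} {v : ℤ} (ht : t ∈ P.ground)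
    (hQ : Q.ground = P.ground.erase t)
    (hb : ∀ b, b ∈ Q.bases ↔ b t = 0 ∧ b + Pi.single t v ∈ P.bases)
    (hv : (∀ a ∈ P.bases, v ≤ a t) ∨ (∀ a ∈ P.bases, a t ≤ v)) : CoeffLE Q P := by
  have hQe := Q.isExchangeFamily
  constructor <;> intro k
  · rw [interiorPoly_eq_activityPoly, interiorPoly_eq_activityPoly, hQ]
    rw [hQ] at hQe
    refine P.isExchangeFamily.coeff_activityPoly_slice_le hQe Function.injective_id ht
      (v := v) ?_ ?_ k
    · simpa using hb
    · simpa using hv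
  · rw [exteriorPoly_eq_activityPoly, exteriorPoly_eq_activityPoly, hQ]
    rw [hQ] at hQe
    -- Negation replaces the value `v` by `-v` and swaps minimal with maximal.
    refine P.isExchangeFamily.neg.coeff_activityPoly_slice_le hQe.neg Function.injective_id ht
      (v := -v) ?_ ?_ k
    · intro b
      simp only [mem_map_equiv, Equiv.neg_symm, Equiv.neg_apply, Set.Finite.mem_toFinset, hb,
        Pi.neg_apply, neg_eq_zero, neg_add, ← Pi.single_neg, neg_neg]
    · simpa [or_comm] using hv

theorem sum_add_single {b : α → ℤ} {t : α} (v : ℤ) (hbt : b t = 0) (I : Finset α) :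
    ∑ x ∈ I, (b + Pi.single t v : α → ℤ) x =
      ∑ x ∈ I.erase t, b x + if t ∈ I then v else 0 := by
  rw [sum_erase _ hbt]
  simp [sum_add_distrib, Pi.single_apply]

/-- The slice is at `f(G) - f(G \ t)`, a lower bound for `a t`, as the other coordinates sum to at
most `f(G \ t)`. -/
theorem coeffLE_delete_singleton (P : IntPolymatroid α) {t : α} (ht : {t} ⊆ P.ground) :
    CoeffLE (P.delete {t} ht) P := by
  have htG : t ∈ P.ground := singleton_subset_iff.1 ht
  have hground : (P.delete {t} ht).ground = P.ground.erase t := sdiff_singleton_eq_erase _ _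
  refine coeffLE_of_slice (v := P.rank P.ground - P.rank (P.ground.erase t)) htG hground
    (fun b => ?_) (.inl fun a ha => ?_)
  · rw [bases, Set.mem_ofPred_eq, hground]
    change ((∀ i ∉ P.ground.erase t, b i = 0) ∧
      (∀ I ⊆ P.ground.erase t, ∑ i ∈ I, b i ≤ P.rank I) ∧
      ∑ i ∈ P.ground.erase t, b i = P.rank (P.ground.erase t)) ↔ _
    constructor
    · rintro ⟨h0, hle, htot⟩
      have hbt : b t = 0 := h0 t (notMem_erase _ _)
      refine ⟨hbt, fun i hi => ?_, fun I hI => ?_, ?_⟩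
      · have hne : i ≠ t := by rintro rfl; exact hi htG
        simp [h0 i fun h => hi (mem_of_mem_erase h), hne]
      · rw [sum_add_single _ hbt]
        have h1 := hle _ (erase_subset_erase t hI)
        split_ifs with htI
        -- Submodularity bounds the chosen value of `t` by `f(I) - f(I \ t)`.
        · have h2 := P.rank_submodular I (P.ground.erase t) hI (erase_subset _ _)
          have h3 : I ∪ P.ground.erase t = P.ground := by
            ext x
            by_cases hx : x = t
            · subst hx; simp [htI, htG]
            · simpa [hx] using fun h => hI h
          rw [h3, inter_erase, inter_eq_left.2 hI] at h2
          linarith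
        · rw [erase_eq_of_notMem htI] at h1 ⊢
          linarith
      · rw [sum_add_single _ hbt, htot, if_pos htG]
        ring
    · rintro ⟨hbt, h0, hle, htot⟩
      refine ⟨fun i hi => ?_, fun I hI => ?_, ?_⟩
      · by_cases hit : i = t
        · rw [hit, hbt]
        · simpa [hit] using h0 i fun h => hi (mem_erase.2 ⟨hit, h⟩)
      · have htI : t ∉ I := fun h => notMem_erase _ _ (hI h)
        have h1 := hle I (hI.trans (erase_subset _ _))
        rwa [sum_add_single _ hbt, if_neg htI, add_zero, erase_eq_of_notMem htI] at h1
      · rw [sum_add_single _ hbt, if_pos htG] at htot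
        linarith
  · have h1 := ha.2.1 _ (erase_subset t P.ground)
    have h2 := ha.2.2
    rw [← sum_erase_add _ _ htG] at h2
    linarith

/-- The slice is at `f({t})`, an upper bound for `a t`. -/
theorem coeffLE_contract_singleton (P : IntPolymatroid α) {t : α} (ht : {t} ⊆ P.ground) :
    CoeffLE (P.contract {t} ht) P := by
  have htG : t ∈ P.ground := singleton_subset_iff.1 ht
  have hground : (P.contract {t} ht).ground = P.ground.erase t := sdiff_singleton_eq_erase _ _
  have hins : ∀ {I : Finset α}, t ∈ I → I.erase t ∪ {t} = I := fun {I} h => by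
    rw [union_comm, ← insert_eq, insert_erase h]
  refine coeffLE_of_slice (v := P.rank {t}) htG hground
    (fun b => ?_) (.inr fun a ha => by simpa using ha.2.1 _ ht)
  rw [bases, Set.mem_ofPred_eq, hground]
  change ((∀ i ∉ P.ground.erase t, b i = 0) ∧
    (∀ I ⊆ P.ground.erase t, ∑ i ∈ I, b i ≤ P.rank (I ∪ {t}) - P.rank {t}) ∧
    ∑ i ∈ P.ground.erase t, b i = P.rank (P.ground.erase t ∪ {t}) - P.rank {t}) ↔ _
  rw [hins htG]
  constructor
  · rintro ⟨h0, hle, htot⟩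
    have hbt : b t = 0 := h0 t (notMem_erase _ _)
    refine ⟨hbt, fun i hi => ?_, fun I hI => ?_, ?_⟩
    · have hne : i ≠ t := by rintro rfl; exact hi htG
      simp [h0 i fun h => hi (mem_of_mem_erase h), hne]
    · rw [sum_add_single _ hbt]
      have h1 := hle _ (erase_subset_erase t hI)
      split_ifs with htI
      · rw [hins htI] at h1
        linarith
      · have h2 := P.rank_submodular I {t} hI ht
        rw [inter_singleton_of_notMem htI, P.rank_empty] at h2
        rw [erase_eq_of_notMem htI] at h1 ⊢
        linarith
    · rw [sum_add_single _ hbt, htot, if_pos htG]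
      ring
  · rintro ⟨hbt, h0, hle, htot⟩
    refine ⟨fun i hi => ?_, fun I hI => ?_, ?_⟩
    · by_cases hit : i = t
      · rw [hit, hbt]
      · simpa [hit] using h0 i fun h => hi (mem_erase.2 ⟨hit, h⟩)
    · have htI : t ∉ I := fun h => notMem_erase _ _ (hI h)
      have h1 := hle (I ∪ {t}) (union_subset (hI.trans (erase_subset _ _)) ht)
      rw [sum_add_single _ hbt, if_pos (by simp), union_comm, ← insert_eq,
        erase_insert htI] at h1
      rw [union_comm, ← insert_eq]
      linarith
    · rw [sum_add_single _ hbt, if_pos htG] at htot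
      linarith

theorem coeffLE_delete (P : IntPolymatroid α) (A : Finset α) (hA : A ⊆ P.ground) :
    CoeffLE (P.delete A hA) P := by
  induction A using Finset.induction_on with
  | empty =>
    refine Same.coeffLE ?_
    have : P.delete ∅ hA = P := by simp [delete]
    rw [this]
    exact ⟨rfl, rfl⟩
  | insert t A ht ih =>
    rw [insert_subset_iff] at hA
    have hsub : {t} ⊆ (P.delete A hA.2).ground :=
      singleton_subset_iff.2 (mem_sdiff.2 ⟨hA.1, ht⟩)
    refine CoeffLE.trans ?_ ((coeffLE_delete_singleton _ hsub).trans (ih hA.2))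
    refine Same.coeffLE ?_
    have : P.delete (insert t A) (insert_subset hA.1 hA.2) =
        (P.delete A hA.2).delete {t} hsub := by
      simp only [delete, mk.injEq, and_true]
      ext x; simp only [mem_sdiff, mem_insert, mem_singleton]; tauto
    rw [this]
    exact ⟨rfl, rfl⟩

theorem coeffLE_contract (P : IntPolymatroid α) (A : Finset α) (hA : A ⊆ P.ground) :
    CoeffLE (P.contract A hA) P := by
  induction A using Finset.induction_on with
  | empty =>
    refine Same.coeffLE ?_
    have : P.contract ∅ hA = P := by simp [contract, P.rank_empty]
    rw [this]
    exact ⟨rfl, rfl⟩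
  | insert t A ht ih =>
    rw [insert_subset_iff] at hA
    have hsub : {t} ⊆ (P.contract A hA.2).ground :=
      singleton_subset_iff.2 (mem_sdiff.2 ⟨hA.1, ht⟩)
    refine CoeffLE.trans ?_ ((coeffLE_contract_singleton _ hsub).trans (ih hA.2))
    refine Same.coeffLE ?_
    have : P.contract (insert t A) (insert_subset hA.1 hA.2) =
        (P.contract A hA.2).contract {t} hsub := by
      simp only [contract, mk.injEq]
      refine ⟨by ext x; simp only [mem_sdiff, mem_insert, mem_singleton]; tauto, funext fun T => ?_⟩
      rw [union_assoc, ← insert_eq]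
      ring
    rw [this]
    exact ⟨rfl, rfl⟩

end IntPolymatroid

theorem theorem4p7 {α : Type*} [LinearOrder α] (P P' : IntPolymatroid α)
    (h : IntPolymatroid.IsMinor P' P) :
    (∀ k : ℕ, P'.interiorPoly.coeff k ≤ P.interiorPoly.coeff k) ∧
      (∀ k : ℕ, P'.exteriorPoly.coeff k ≤ P.exteriorPoly.coeff k) := by
  obtain ⟨A, B, hA, hB, hAB, h | h⟩ := h
  · exact h.coeffLE.trans ((IntPolymatroid.coeffLE_contract _ _ _).trans
      (IntPolymatroid.coeffLE_delete _ _ _))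
  · exact h.coeffLE.trans ((IntPolymatroid.coeffLE_delete _ _ _).trans
      (IntPolymatroid.coeffLE_contract _ _ _))
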